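/- Let $n$ be a natural number ($n=0$, when $\mathbb R^n$ is one point of measure $1$, is allowed), and write $|E|$ for the Lebesgue measure of $E\subset\mathbb R^n$. In $[0,\infty]$ use $0\cdot\infty=0$ and $\inf\emptyset=\infty$. For $\Phi:[0,\infty]\to[0,\infty]$ put $a(\Phi)=\sup\{t\ge0:\Phi(t)=0\}$ and $b(\Phi)=\inf\{t\ge0:\Phi(t)=\infty\}$. A non-decreasing function $\Phi:[0,\infty]\to[0,\infty]$ is a Young function if $a(\Phi)<\infty$ and $b(\Phi)>0$; $\lim_{t\to0}\Phi(t)=\Phi(0)=0$; $\Phi$ is convex on $[0,b(\Phi))$; $\lim_{t\to\infty}\Phi(t)=\Phi(\infty)=\infty$ in case $b(\Phi)=\infty$; and $\lim_{t\to b(\Phi)-0}\Phi(t)=\Phi(b(\Phi))$ in case $b(\Phi)<\infty$. It satisfies $\Phi\in\nabla_2$ if for some real $k>1$ one has $\Phi(r)\le\frac1{2k}\Phi(kr)$ for all $r\ge0$. Put $\Phi^{-1}(u)=\inf\{t\ge0:\Phi(t)>u\}$ for $0\le u<\infty$ and $\Phi^{-1}(\infty)=\infty$. Let $L^0(\mathbb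 R^n)$ be the set of Lebesgue measurable functions that are finite almost everywhere. For measurable $f$ let $m(f,t)=|\{x:|f(x)|>t\}|$ and $f^*(t)=\inf\{\alpha>0:m(f,\alpha)\le t\}$, $t>0$. For $0<q\le\infty$ let $L^{\Phi,q}(\mathbb R^n)$ be the set of all $f\in L^0(\mathbb R^n)$ with $\|f\|_{L^{\Phi,q}}<\infty$, where $$\|f\|_{L^{\Phi,q}}=\left(\int_0^\infty\Big[\Phi^{-1}\big(\tfrac1t\big)^{-1}f^*(t)\Big]^q\frac{dt}t\right)^{1/q}\ (q<\infty),\qquad \|f\|_{L^{\Phi,\infty}}=\sup_{t>0}\Phi^{-1}\big(\tfrac1t\big)^{-1}f^*(t).$$ Let $\mathrm wL^\Phi(\mathbb R^n)$ be the set of all $f\in L^0(\mathbb R^n)$ with $\sup_{t>0}\Phi(t)\,m(kf,t)<\infty$ for some $k>0$, and let $\|f\|_{\mathrm wL^\Phi}=\inf\{\lambda>0:\sup_{t>0}\Phi(t)\,m(f/\lambda,t)\le1\}$. Finally, let $Mf(x)=\sup_{Q\ni x}\frac1{|Q|}\int_Q|f(y)|\,dy$, the supremum being over all cubes $Q$ with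 sides parallel to the coordinate axes that contain $x$. **Theorem.** Let $\Phi$ be a Young function with $\Phi\in\nabla_2$. (1) For every $0<q\le\infty$ the Hardy-Littlewood maximal operator $M$ is bounded on $L^{\Phi,q}(\mathbb R^n)$: there is a constant $C<\infty$, depending only on $n,\Phi,q$, such that for every complex-valued $f\in L^{\Phi,q}(\mathbb R^n)$ one has $Mf\in L^{\Phi,q}(\mathbb R^n)$ and $\|Mf\|_{L^{\Phi,q}}\le C\|f\|_{L^{\Phi,q}}$. (2) In particular, $M$ is bounded on $\mathrm wL^\Phi(\mathbb R^n)$: there is a constant $C<\infty$, depending only on $n,\Phi$, such that for every complex-valued $f\in\mathrm wL^\Phi(\mathbb R^n)$ one has $Mf\in\mathrm wL^\Phi(\mathbb R^n)$ and $\|Mf\|_{\mathrm wL^\Phi}\le C\|f\|_{\mathrm wL^\Phi}$. -/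

import Mathlib

open MeasureTheory Filter Topology
open scoped ENNReal NNReal

noncomputable section

namespace OrliczLorentz

/-- `a(Φ) = sup {t ≥ 0 : Φ(t) = 0}`. -/
def zeroBound (Φ : ℝ≥0∞ → ℝ≥0∞) : ℝ≥0∞ := sSup {t | Φ t = 0}

/-- `b(Φ) = inf {t ≥ 0 : Φ(t) = ∞}`. -/
def topBound (Φ : ℝ≥0∞ → ℝ≥0∞) : ℝ≥0∞ := sInf {t | Φ t = ∞}

/-- Young functions `Φ : [0,∞] → [0,∞]`. -/
structure IsYoung (Φ : ℝ≥0∞ → ℝ≥0∞) : Prop where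
  monotone : Monotone Φ
  zeroBound_lt_top : zeroBound Φ < ∞
  topBound_pos : 0 < topBound Φ
  map_zero : Φ 0 = 0
  tendsto_zero : Tendsto Φ (𝓝[>] 0) (𝓝 0)
  convexOn : ConvexOn ℝ≥0 (Set.Iio (topBound Φ)) Φ
  map_top_of_eq : topBound Φ = ∞ → Φ ∞ = ∞
  tendsto_top_of_eq : topBound Φ = ∞ → Tendsto Φ (𝓝[<] ∞) (𝓝 ∞)
  tendsto_of_lt : topBound Φ < ∞ → Tendsto Φ (𝓝[<] (topBound Φ)) (𝓝 (Φ (topBound Φ)))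

/-- The `∇₂`-condition: for some `k > 1`, `Φ(r) ≤ Φ(k r) / (2 k)` for all `r ≥ 0`. -/
def Nabla2 (Φ : ℝ≥0∞ → ℝ≥0∞) : Prop :=
  ∃ k : ℝ≥0, 1 < k ∧ ∀ r : ℝ≥0, Φ r ≤ (1 / (2 * (k : ℝ≥0∞))) * Φ (k * r)

/-- The generalized inverse `Φ⁻¹(u) = inf {t ≥ 0 : Φ(t) > u}`. As `inf ∅ = ∞` in `[0,∞]`, this
gives `Φ⁻¹(∞) = ∞`. -/
def youngInv (Φ : ℝ≥0∞ → ℝ≥0∞) (u : ℝ≥0∞) : ℝ≥0∞ := sInf {t | u < Φ t}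

/-- The distribution function `m(g, t) = |{x ∈ ℝⁿ : g(x) > t}|` of a `[0,∞]`-valued function. It is
used with `g = |f|` and with its multiples. -/
def distribFun {n : ℕ} (g : (Fin n → ℝ) → ℝ≥0∞) (t : ℝ≥0∞) : ℝ≥0∞ :=
  volume {x | t < g x}

section

/- The codomain `ε` is `ℂ` for the functions on which the maximal operator acts, and `[0,∞]` for the
maximal functions themselves; `‖f x‖ₑ` is `|f(x)|` as an element of `[0,∞]`. -/
variable {ε : Type*} [TopologicalSpace ε] [ContinuousENorm ε] {n : ℕ}

/-- The decreasing rearrangement `f*(t) = inf {α > 0 : m(f, α) ≤ t}`. -/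
def rearrangement (f : (Fin n → ℝ) → ε) (t : ℝ≥0∞) : ℝ≥0∞ :=
  sInf {α | 0 < α ∧ distribFun (fun x => ‖f x‖ₑ) α ≤ t}

/-- `f ∈ L⁰(ℝⁿ)`: (Lebesgue) measurable and finite almost everywhere. -/
def MemL0 (f : (Fin n → ℝ) → ε) : Prop :=
  AEStronglyMeasurable f volume ∧ ∀ᵐ x, ‖f x‖ₑ < ∞

/-- The Orlicz-Lorentz quasi-norm of `L^{Φ,q}(ℝⁿ)`. -/
def orliczLorentzNorm (Φ : ℝ≥0∞ → ℝ≥0∞) (q : ℝ≥0∞) (f : (Fin n → ℝ) → ε) : ℝ≥0∞ :=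
  if q = ∞ then
    ⨆ (t : ℝ) (_ : 0 < t),
      (youngInv Φ (1 / ENNReal.ofReal t))⁻¹ * rearrangement f (ENNReal.ofReal t)
  else
    (∫⁻ t in Set.Ioi (0 : ℝ),
      ((youngInv Φ (1 / ENNReal.ofReal t))⁻¹ * rearrangement f (ENNReal.ofReal t)) ^ q.toReal
        / ENNReal.ofReal t) ^ (1 / q.toReal)

/-- `f ∈ L^{Φ,q}(ℝⁿ)`. -/
def MemOrliczLorentz (Φ : ℝ≥0∞ → ℝ≥0∞) (q : ℝ≥0∞) (f : (Fin n → ℝ) → ε) : Prop :=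
  MemL0 f ∧ orliczLorentzNorm Φ q f < ∞

/-- `f ∈ wL^Φ(ℝⁿ)`: `sup_{t > 0} Φ(t) m(k f, t) < ∞` for some `k > 0`. -/
def MemWeakOrlicz (Φ : ℝ≥0∞ → ℝ≥0∞) (f : (Fin n → ℝ) → ε) : Prop :=
  MemL0 f ∧ ∃ k : ℝ≥0, 0 < k ∧
    (⨆ (t : ℝ≥0) (_ : 0 < t), Φ t * distribFun (fun x => k * ‖f x‖ₑ) t) < ∞

/-- The quasi-norm of `wL^Φ(ℝⁿ)`:
`inf {l > 0 : sup_{t > 0} Φ(t) m(f / l, t) ≤ 1}`, the infimum over finite `l`. -/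
def weakOrliczNorm (Φ : ℝ≥0∞ → ℝ≥0∞) (f : (Fin n → ℝ) → ε) : ℝ≥0∞ :=
  sInf {l : ℝ≥0∞ | 0 < l ∧ l < ∞ ∧
    (⨆ (t : ℝ≥0) (_ : 0 < t), Φ t * distribFun (fun x => ‖f x‖ₑ / l) t) ≤ 1}

/-- The (open) cube with centre `c`, side length `2 r`, and sides parallel to the axes. -/
def cube (c : Fin n → ℝ) (r : ℝ) : Set (Fin n → ℝ) := {y | ∀ i, |y i - c i| < r}

/-- The Hardy-Littlewood maximal function, the supremum of the averages of `|f|` over the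
axis-parallel cubes containing `x`. -/
def maximalFun (f : (Fin n → ℝ) → ε) (x : Fin n → ℝ) : ℝ≥0∞ :=
  ⨆ (c : Fin n → ℝ) (r : ℝ) (_ : 0 < r) (_ : x ∈ cube c r),
    (1 / volume (cube c r)) * ∫⁻ y in cube c r, ‖f y‖ₑ

end

end OrliczLorentz

end

namespace OrliczLorentz

/-! Everything rests on a pointwise bound for the rearrangement. Cut `f` at the levels `f*(a^j t)`,
where `a < 1`. Up to a null set, `|f| ≤ f*(t) + g`, where `g` is a layered sum with `∫ g ≤ t S` and
`S = ∑ a^j f*(a^(j+1) t)`. The weak type (1,1) inequality for `Mg` then yields `(Mf)*(t) ≤ (5^n + 1)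
S` (`rearrangement_maximalFun_le`).

Take `a = 1/(2k)`, with `k` from `∇₂`. Iterating `∇₂` gives `Φ⁻¹((2k)^j u) ≤ k^j Φ⁻¹(u)`, so moving
the weight `Φ⁻¹(1/t)⁻¹` to the point `a^(j+1) t` costs `k^(j+1)`. Against `a^j` this leaves `k
2^(-j)`, which is summable. Since `dt/t` is invariant under dilations, all terms have the same
`L^q(dt/t)` norm, and this gives (1) for every `q > 0` (`exists_logNorm_le`).

For (2), `wL^Φ` and `L^{Φ,∞}` have the same quasi-norm and the same members, so it is the case `q =
∞`. -/

theorem cube_eq_ball {n : ℕ} (c : Fin n → ℝ) {r : ℝ} (hr : 0 < r) :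
    cube c r = Metric.ball c r := by
  ext y
  simp [cube, dist_pi_lt_iff hr, Real.dist_eq]

theorem volume_closedBall_five_mul {n : ℕ} (c : Fin n → ℝ) {r : ℝ} (hr : 0 < r) :
    volume (Metric.closedBall c (5 * r)) = 5 ^ n * volume (Metric.ball c r) := by
  rw [Measure.addHaar_closedBall _ _ (by positivity), Measure.addHaar_ball_of_pos _ _ hr, mul_pow,
    ENNReal.ofReal_mul (by positivity), Module.finrank_fin_fun,
    ENNReal.ofReal_pow (by norm_num : (0 : ℝ) ≤ 5)]
  simp [mul_assoc]

/-! ### Measurability and weak type (1,1) of the maximal function -/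

section

variable {ε : Type*} [TopologicalSpace ε] [ContinuousENorm ε] {n : ℕ}

theorem lt_maximalFun_iff {f : (Fin n → ℝ) → ε} {x : Fin n → ℝ} {l : ℝ≥0∞} :
    l < maximalFun f x ↔ ∃ c r, 0 < r ∧ x ∈ cube c r ∧
      l < (1 / volume (cube c r)) * ∫⁻ y in cube c r, ‖f y‖ₑ := by
  simp only [maximalFun, lt_iSup_iff, exists_prop]

theorem isOpen_lt_maximalFun (f : (Fin n → ℝ) → ε) (l : ℝ≥0∞) :
    IsOpen {x | l < maximalFun f x} := by
  rw [isOpen_iff_mem_nhds]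
  intro x hx
  obtain ⟨c, r, hr, hxc, h⟩ := lt_maximalFun_iff.1 hx
  have ho : IsOpen (cube c r) := by rw [cube_eq_ball c hr]; exact Metric.isOpen_ball
  exact Filter.mem_of_superset (ho.mem_nhds hxc)
    fun y hy => lt_maximalFun_iff.2 ⟨c, r, hr, hy, h⟩

theorem measurable_maximalFun (f : (Fin n → ℝ) → ε) : Measurable (maximalFun f) :=
  measurable_of_Ioi fun l => (isOpen_lt_maximalFun f l).measurableSet

/-- The weak type `(1, 1)` inequality for the maximal operator. -/
theorem mul_volume_lt_maximalFun_le (f : (Fin n → ℝ) → ε) (l : ℝ≥0∞) :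
    l * volume {x | l < maximalFun f x} ≤ 5 ^ n * ∫⁻ x, ‖f x‖ₑ := by
  -- Inner regularity reduces to compact subsets, where a finite subcover supplies the bounded radii
  -- that Vitali's lemma requires.
  rw [(isOpen_lt_maximalFun f l).measure_eq_iSup_isCompact]
  simp only [ENNReal.mul_iSup]
  refine iSup₂_le fun K hKU => iSup_le fun hK => ?_
  have hU : ∀ x : {x | l < maximalFun f x}, ∃ c r, 0 < r ∧ x.1 ∈ cube c r ∧
      l < (1 / volume (cube c r)) * ∫⁻ y in cube c r, ‖f y‖ₑ := fun x => lt_maximalFun_iff.1 x.2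
  choose c r hr hxc hl using hU
  have hball : ∀ x, l * volume (Metric.ball (c x) (r x)) ≤
      ∫⁻ y in Metric.ball (c x) (r x), ‖f y‖ₑ := by
    intro x
    have h := (hl x).le
    rw [cube_eq_ball _ (hr x), one_div, mul_comm, ← div_eq_mul_inv] at h
    exact (ENNReal.le_div_iff_mul_le (Or.inl (Metric.measure_ball_pos _ _ (hr x)).ne')
      (Or.inl measure_ball_lt_top.ne)).1 h
  obtain ⟨T, hT⟩ := hK.elim_finite_subcover (fun x => Metric.ball (c x) (r x))
    (fun x => Metric.isOpen_ball) (fun x hx => Set.mem_iUnion.2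
      ⟨⟨x, hKU hx⟩, by rw [← cube_eq_ball _ (hr _)]; exact hxc ⟨x, hKU hx⟩⟩)
  obtain ⟨R, hR⟩ := (T.finite_toSet.image r).bddAbove
  obtain ⟨u, huT, hdisj, hcov⟩ := Vitali.exists_disjoint_subfamily_covering_enlargement_closedBall
    (T : Set _) c r R (fun a ha => hR (Set.mem_image_of_mem _ ha)) 5 (by norm_num)
  have hfin : u.Finite := T.finite_toSet.subset huT
  have hKu : K ⊆ ⋃ b ∈ hfin.toFinset, Metric.closedBall (c b) (5 * r b) := by
    intro x hx
    obtain ⟨a, ha, hxa⟩ := Set.mem_iUnion₂.1 (hT hx)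
    obtain ⟨b, hb, hab⟩ := hcov a ha
    exact Set.mem_iUnion₂.2 ⟨b, hfin.mem_toFinset.2 hb, hab (Metric.ball_subset_closedBall hxa)⟩
  calc l * volume K
      ≤ l * ∑ b ∈ hfin.toFinset, volume (Metric.closedBall (c b) (5 * r b)) := by
        gcongr
        exact (measure_mono hKu).trans (measure_biUnion_finset_le _ _)
    _ = 5 ^ n * ∑ b ∈ hfin.toFinset, l * volume (Metric.ball (c b) (r b)) := by
        simp only [Finset.mul_sum]
        refine Finset.sum_congr rfl fun b _ => ?_
        rw [volume_closedBall_five_mul _ (hr b)]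
        ring
    _ ≤ 5 ^ n * ∑ b ∈ hfin.toFinset, ∫⁻ y in Metric.ball (c b) (r b), ‖f y‖ₑ := by
        gcongr with b
        exact hball b
    _ = 5 ^ n * ∫⁻ y in ⋃ b ∈ hfin.toFinset, Metric.ball (c b) (r b), ‖f y‖ₑ := by
        rw [lintegral_biUnion_finset _ (fun b _ => measurableSet_ball)]
        intro a ha b hb hab
        exact (hdisj (hfin.mem_toFinset.1 ha) (hfin.mem_toFinset.1 hb) hab).mono
          Metric.ball_subset_closedBall Metric.ball_subset_closedBall
    _ ≤ 5 ^ n * ∫⁻ x, ‖f x‖ₑ := by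
        gcongr 1
        exact setLIntegral_le_lintegral _ _

theorem maximalFun_le_add {ε' : Type*} [TopologicalSpace ε'] [ContinuousENorm ε']
    {f : (Fin n → ℝ) → ε} {g : (Fin n → ℝ) → ε'} {l : ℝ≥0∞}
    (h : ∀ᵐ x, ‖f x‖ₑ ≤ l + ‖g x‖ₑ) (x : Fin n → ℝ) :
    maximalFun f x ≤ l + maximalFun g x := by
  refine iSup_le fun c => iSup_le fun r => iSup_le fun hr => iSup_le fun hx => ?_
  have hv0 : volume (cube c r) ≠ 0 := by
    rw [cube_eq_ball _ hr]; exact (Metric.measure_ball_pos _ _ hr).ne'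
  have hvt : volume (cube c r) ≠ ∞ := by
    rw [cube_eq_ball _ hr]; exact measure_ball_lt_top.ne
  calc (1 / volume (cube c r)) * ∫⁻ y in cube c r, ‖f y‖ₑ
      ≤ (1 / volume (cube c r)) * ∫⁻ y in cube c r, (l + ‖g y‖ₑ) := by
        gcongr 1
        exact lintegral_mono_ae (ae_restrict_of_ae h)
    _ = l + (1 / volume (cube c r)) * ∫⁻ y in cube c r, ‖g y‖ₑ := by
        rw [lintegral_add_left measurable_const, setLIntegral_const, mul_add, mul_comm l,
          ← mul_assoc, one_div, ENNReal.inv_mul_cancel hv0 hvt, one_mul]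
    _ ≤ l + maximalFun g x := by
        gcongr
        exact le_iSup_of_le c (le_iSup_of_le r (le_iSup_of_le hr (le_iSup_of_le hx le_rfl)))

/-! ### Decreasing rearrangements -/

theorem distribFun_antitone (g : (Fin n → ℝ) → ℝ≥0∞) : Antitone (distribFun g) :=
  fun _ _ h => measure_mono fun _ hx => h.trans_lt hx

theorem rearrangement_antitone (f : (Fin n → ℝ) → ε) : Antitone (rearrangement f) :=
  fun _ _ h => sInf_le_sInf fun _ hα => ⟨hα.1, hα.2.trans h⟩

theorem rearrangement_le_of_forall_gt {f : (Fin n → ℝ) → ε} {t l : ℝ≥0∞}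
    (h : ∀ α, l < α → α ≠ ∞ → distribFun (fun x => ‖f x‖ₑ) α ≤ t) : rearrangement f t ≤ l := by
  refine le_of_forall_gt_imp_ge_of_dense fun α hα => ?_
  rcases eq_or_ne α ∞ with rfl | hα'
  · exact le_top
  · exact sInf_le ⟨(zero_le).trans_lt hα, h α hα hα'⟩

/-- The infimum defining `f*(t)` is attained at the level of measures: continuity from below along a
sequence of admissible levels decreasing to it. -/
theorem distribFun_rearrangement_le (f : (Fin n → ℝ) → ε) (t : ℝ≥0∞) :
    distribFun (fun x => ‖f x‖ₑ) (rearrangement f t) ≤ t := by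
  set S := {α | 0 < α ∧ distribFun (fun x => ‖f x‖ₑ) α ≤ t} with hS
  have hne : S.Nonempty := ⟨∞, by simp [hS, distribFun]⟩
  obtain ⟨u, hu, hlim, huS⟩ := exists_seq_tendsto_sInf hne (OrderBot.bddBelow S)
  have hsub : {x | rearrangement f t < ‖f x‖ₑ} ⊆ ⋃ i, {x | u i < ‖f x‖ₑ} := by
    intro x hx
    obtain ⟨i, hi⟩ := (hlim.eventually (gt_mem_nhds hx)).exists
    exact Set.mem_iUnion.2 ⟨i, hi⟩
  refine (measure_mono hsub).trans ?_
  have hmono : Monotone fun i => {x | u i < ‖f x‖ₑ} :=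
    fun i j hij x (hx : u i < ‖f x‖ₑ) => (hu hij).trans_lt hx
  rw [hmono.measure_iUnion]
  exact iSup_le fun i => (huS i).2

theorem distribFun_le_of_rearrangement_le {f : (Fin n → ℝ) → ε} {t l : ℝ≥0∞}
    (h : rearrangement f t ≤ l) : distribFun (fun x => ‖f x‖ₑ) l ≤ t :=
  (distribFun_antitone _ h).trans (distribFun_rearrangement_le f t)

/-- The decreasing rearrangement of `M f` is controlled by a discretised average of that of `f`. -/
theorem rearrangement_maximalFun_le (f : (Fin n → ℝ) → ε)
    {a t : ℝ≥0∞} (ha : a < 1) (ht' : t ≠ ∞) :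
    rearrangement (maximalFun f) t ≤
      (5 ^ n + 1) * ∑' j : ℕ, a ^ j * rearrangement f (a ^ (j + 1) * t) := by
  set S := ∑' j : ℕ, a ^ j * rearrangement f (a ^ (j + 1) * t) with hSdef
  -- Measurable hulls, because `f` is not assumed measurable; their measure is still at most `a^j
  -- t`.
  set F : ℕ → Set (Fin n → ℝ) :=
    fun j => toMeasurable volume {x | rearrangement f (a ^ j * t) < ‖f x‖ₑ} with hF
  set g : (Fin n → ℝ) → ℝ≥0∞ :=
    fun x => ∑' j, (F j).indicator (fun _ => rearrangement f (a ^ (j + 1) * t)) x with hg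
  have hvol : ∀ j, volume (F j) ≤ a ^ j * t := fun j => by
    rw [hF, measure_toMeasurable]; exact distribFun_rearrangement_le f _
  have hint : ∫⁻ x, ‖g x‖ₑ ≤ t * S := by
    simp only [enorm_eq_self, hg]
    rw [lintegral_tsum fun j => (measurable_const.indicator
      (measurableSet_toMeasurable _ _)).aemeasurable, hSdef, ← ENNReal.tsum_mul_left]
    refine ENNReal.tsum_le_tsum fun j => ?_
    rw [lintegral_indicator_const (measurableSet_toMeasurable _ _)]
    calc _ ≤ rearrangement f (a ^ (j + 1) * t) * (a ^ j * t) := by gcongr; exact hvol j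
      _ = _ := by ring
  have hnull : volume {x | ∀ j, rearrangement f (a ^ j * t) < ‖f x‖ₑ} = 0 := by
    have hlim : Tendsto (fun j => a ^ j * t) atTop (𝓝 0) := by
      simpa using ENNReal.Tendsto.mul_const (ENNReal.tendsto_pow_atTop_nhds_zero_of_lt_one ha)
        (Or.inr ht')
    refine le_antisymm (ge_of_tendsto' hlim fun j => ?_) (zero_le)
    exact (measure_mono (Set.ofPred_subset_ofPred.2 fun x hx => hx j)).trans
      (distribFun_rearrangement_le f _)
  have hfg : ∀ᵐ x, ‖f x‖ₑ ≤ rearrangement f t + ‖g x‖ₑ := by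
    have h0 : ∀ᵐ x, ¬ ∀ j, rearrangement f (a ^ j * t) < ‖f x‖ₑ :=
      measure_eq_zero_iff_ae_notMem.1 hnull
    filter_upwards [h0] with x hx
    classical
    have hex : ∃ j, ‖f x‖ₑ ≤ rearrangement f (a ^ j * t) := by simpa using hx
    rcases hj : Nat.find hex with _ | j
    · have := Nat.find_spec hex
      rw [hj, pow_zero, one_mul] at this
      exact this.trans le_self_add
    · have h1 := Nat.find_spec hex
      -- Where `f*(a^j t) < |f| ≤ f*(a^(j+1) t)`, the `j`-th layer of `g` alone dominates `|f|`.
      have h2 := Nat.find_min hex (m := j) (by omega)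
      rw [hj] at h1
      have hxF : x ∈ F j := subset_toMeasurable _ _ (not_le.1 h2)
      refine le_trans ?_ le_add_self
      refine h1.trans (le_trans ?_ (ENNReal.le_tsum j))
      rw [Set.indicator_of_mem hxF]
  have hS0 : rearrangement f t ≤ S := by
    refine le_trans ?_ (ENNReal.le_tsum 0)
    rw [pow_zero, one_mul, zero_add, pow_one]
    exact rearrangement_antitone f (mul_le_of_le_one_left (zero_le) ha.le)
  refine rearrangement_le_of_forall_gt fun α hα hα' => ?_
  have hST : S ≠ ∞ := by
    intro h
    rw [h, ENNReal.mul_top (by simp)] at hα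
    exact not_top_lt hα
  -- As `Mf ≤ S + Mg`, the weak type bound is applied to `Mg` at level `α - S`. The strict
  -- inequality makes this level positive even when `S = 0`, so it can be cancelled at the end.
  have hgt : 5 ^ n * S < α - S := by
    rw [lt_tsub_iff_right]
    calc _ = (5 ^ n + 1) * S := by ring
      _ < α := hα
  have hαS : α - S ≠ 0 := (zero_le).trans_lt hgt |>.ne'
  have hsub : {x | α < ‖maximalFun f x‖ₑ} ⊆ {x | α - S < maximalFun g x} := by
    intro x hx
    have h := (lt_of_lt_of_le hx (maximalFun_le_add hfg x)).trans_le (add_le_add_left hS0 _)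
    by_contra hcon
    have h3 : S ≤ α := (tsub_pos_iff_lt.1 (pos_iff_ne_zero.2 hαS)).le
    exact absurd h (not_lt.2 ((add_le_add_right (not_lt.1 hcon) S).trans
      (add_tsub_cancel_of_le h3).le))
  refine (measure_mono hsub).trans ?_
  have hw := mul_volume_lt_maximalFun_le g (α - S)
  have hαT : α - S ≠ ∞ := ne_top_of_le_ne_top hα' tsub_le_self
  have : (α - S) * volume {x | α - S < maximalFun g x} ≤ (α - S) * t := by
    refine hw.trans ?_
    calc 5 ^ n * ∫⁻ x, ‖g x‖ₑ ≤ 5 ^ n * (t * S) := by gcongr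
      _ = (5 ^ n * S) * t := by ring
      _ ≤ _ := by gcongr
  exact (ENNReal.mul_le_mul_iff_right hαS hαT).1 this

end

/-! ### Generalized inverses and the `∇₂` condition -/

theorem IsYoung.exists_lt {Φ : ℝ≥0∞ → ℝ≥0∞} (hΦ : IsYoung Φ) {u : ℝ≥0∞} (hu : u ≠ ∞) :
    ∃ t, t < ∞ ∧ u < Φ t := by
  rcases eq_or_ne (topBound Φ) ∞ with hb | hb
  · have h := (hΦ.tendsto_top_of_eq hb).eventually (lt_mem_nhds hu.lt_top)
    have h2 : ∀ᶠ t in 𝓝[<] (∞ : ℝ≥0∞), t < ∞ := eventually_mem_nhdsWithin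
    have : (𝓝[<] (∞ : ℝ≥0∞)).NeBot := nhdsLT_neBot_of_exists_lt ⟨0, ENNReal.zero_lt_top⟩
    exact (h2.and h).exists
  · obtain ⟨t, ht, ht'⟩ := sInf_lt_iff.1 (lt_top_iff_ne_top.2 hb)
    exact ⟨t, ht', hu.lt_top.trans_eq (Eq.symm ht)⟩

/-- Keeps the weight `Φ⁻¹(1/t)⁻¹` nonzero for `t > 0`, so that a finite weighted value forces
`f*(t)` to be finite. -/
theorem IsYoung.youngInv_ne_top {Φ : ℝ≥0∞ → ℝ≥0∞} (hΦ : IsYoung Φ) {u : ℝ≥0∞} (hu : u ≠ ∞) :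
    youngInv Φ u ≠ ∞ := by
  obtain ⟨t, ht, hut⟩ := hΦ.exists_lt hu
  exact ne_top_of_le_ne_top ht.ne (sInf_le hut)

theorem youngInv_mono (Φ : ℝ≥0∞ → ℝ≥0∞) : Monotone (youngInv Φ) :=
  fun _ _ h => sInf_le_sInf fun _ ht => h.trans_lt ht

section Nabla2

variable {Φ : ℝ≥0∞ → ℝ≥0∞} {k : ℝ≥0}

theorem two_mul_pow_mul_le (hk : 1 < k)
    (h : ∀ r : ℝ≥0, Φ r ≤ (1 / (2 * (k : ℝ≥0∞))) * Φ (k * r)) (j : ℕ) (r : ℝ≥0) :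
    (2 * (k : ℝ≥0∞)) ^ j * Φ r ≤ Φ (k ^ j * r) := by
  have hk0 : (2 * (k : ℝ≥0∞)) ≠ 0 := by simpa using (zero_lt_one.trans hk).ne'
  have hkt : (2 * (k : ℝ≥0∞)) ≠ ∞ := by finiteness
  have step : ∀ r : ℝ≥0, (2 * (k : ℝ≥0∞)) * Φ r ≤ Φ (k * r) := fun r => by
    calc _ ≤ (2 * (k : ℝ≥0∞)) * ((1 / (2 * (k : ℝ≥0∞))) * Φ (k * r)) := by gcongr; exact h r
      _ = _ := by rw [← mul_assoc, one_div, ENNReal.mul_inv_cancel hk0 hkt, one_mul]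
  induction j with
  | zero => simp
  | succ j ih =>
    calc _ = (2 * (k : ℝ≥0∞)) * ((2 * (k : ℝ≥0∞)) ^ j * Φ r) := by ring
      _ ≤ (2 * (k : ℝ≥0∞)) * Φ (k ^ j * r) := by gcongr
      _ ≤ Φ (k * (k ^ j * r)) := by simpa using step (k ^ j * r)
      _ = _ := by ring_nf

/-- If `Φ(r) > u`, iterated `∇₂` gives `Φ(k^j r) > (2k)^j u`, so `k^j r` competes in the infimum on
the left. -/
theorem youngInv_two_mul_pow_mul_le (hk : 1 < k)
    (h : ∀ r : ℝ≥0, Φ r ≤ (1 / (2 * (k : ℝ≥0∞))) * Φ (k * r)) (j : ℕ) (u : ℝ≥0∞) :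
    youngInv Φ ((2 * (k : ℝ≥0∞)) ^ j * u) ≤ k ^ j * youngInv Φ u := by
  have hk0 : (k : ℝ≥0∞) ≠ 0 := by simpa using (zero_lt_one.trans hk).ne'
  rw [← ENNReal.div_le_iff' (pow_ne_zero _ hk0) (by finiteness)]
  refine le_sInf fun r hr => ?_
  rw [ENNReal.div_le_iff' (pow_ne_zero _ hk0) (by finiteness)]
  induction r with
  | top => rw [ENNReal.mul_top (pow_ne_zero _ hk0)]; exact le_top
  | coe r =>
    refine sInf_le (lt_of_lt_of_le ?_ (two_mul_pow_mul_le hk h j r))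
    have hp0 : (2 * (k : ℝ≥0∞)) ^ j ≠ 0 := pow_ne_zero _ (mul_ne_zero two_ne_zero hk0)
    exact (ENNReal.mul_lt_mul_iff_right hp0 (by finiteness)).2 hr

end Nabla2

/-! ### The weighted pointwise estimate -/

section

variable {ε : Type*} [TopologicalSpace ε] [ContinuousENorm ε] {n : ℕ}

/-- The function `t ↦ Φ⁻¹(1/t)⁻¹ f*(t)` whose `L^q(dt/t)` norm is the norm of `L^{Φ,q}`. -/
noncomputable def weightedRearrangement (Φ : ℝ≥0∞ → ℝ≥0∞) (f : (Fin n → ℝ) → ε) (t : ℝ≥0∞) :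
    ℝ≥0∞ :=
  (youngInv Φ (1 / t))⁻¹ * rearrangement f t

theorem measurable_weightedRearrangement (Φ : ℝ≥0∞ → ℝ≥0∞) (f : (Fin n → ℝ) → ε) :
    Measurable (weightedRearrangement Φ f) := by
  have h : Antitone fun t : ℝ≥0∞ => youngInv Φ (1 / t) :=
    fun s t hst => youngInv_mono Φ (ENNReal.div_le_div_left hst 1)
  exact h.measurable.inv.mul (rearrangement_antitone f).measurable

/-- The coefficient `a^j` meets the weight loss `k^(j+1)`; the factor 2 in `∇₂` is what leaves a
geometric series. -/
theorem weightedRearrangement_maximalFun_le {Φ : ℝ≥0∞ → ℝ≥0∞} {k : ℝ≥0} (hk : 1 < k)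
    (h : ∀ r : ℝ≥0, Φ r ≤ (1 / (2 * (k : ℝ≥0∞))) * Φ (k * r)) (f : (Fin n → ℝ) → ε)
    {t : ℝ≥0∞} (ht' : t ≠ ∞) :
    weightedRearrangement Φ (maximalFun f) t ≤ ((5 ^ n + 1) * k) *
      ∑' j : ℕ, 2⁻¹ ^ j * weightedRearrangement Φ f ((2 * (k : ℝ≥0∞))⁻¹ ^ (j + 1) * t) := by
  have hk0 : (k : ℝ≥0∞) ≠ 0 := by simpa using (zero_lt_one.trans hk).ne'
  have hkt : (k : ℝ≥0∞) ≠ ∞ := ENNReal.coe_ne_top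
  set a : ℝ≥0∞ := (2 * (k : ℝ≥0∞))⁻¹ with ha
  have hak : a * k = 2⁻¹ := by
    rw [ha, ENNReal.mul_inv (Or.inl two_ne_zero) (Or.inl ENNReal.ofNat_ne_top), mul_assoc,
      ENNReal.inv_mul_cancel hk0 hkt, mul_one]
  have ha1 : a < 1 := by
    rw [ha, ENNReal.inv_lt_one]
    have : (1 : ℝ≥0) < 2 * k := by
      calc (1 : ℝ≥0) < k := hk
        _ ≤ 2 * k := le_mul_of_one_le_left zero_le one_le_two
    exact_mod_cast this
  have hw : ∀ j : ℕ, (youngInv Φ (1 / t))⁻¹ ≤ k ^ j * (youngInv Φ (1 / (a ^ j * t)))⁻¹ := by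
    intro j
    have h1 : 1 / (a ^ j * t) = (2 * (k : ℝ≥0∞)) ^ j * (1 / t) := by
      rw [one_div, one_div, ENNReal.mul_inv (Or.inr ht')
        (Or.inl (by rw [ha]; exact ENNReal.pow_ne_top (by simp [hk0]))), ha, ← ENNReal.inv_pow,
        inv_inv]
    have h2 := ENNReal.inv_le_inv.2 (youngInv_two_mul_pow_mul_le hk h j (1 / t))
    rw [ENNReal.mul_inv (Or.inl (pow_ne_zero _ hk0)) (Or.inl (by finiteness))] at h2
    rw [h1]
    calc (youngInv Φ (1 / t))⁻¹
        = (k : ℝ≥0∞) ^ j * (((k : ℝ≥0∞) ^ j)⁻¹ * (youngInv Φ (1 / t))⁻¹) := by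
          rw [← mul_assoc, ENNReal.mul_inv_cancel (pow_ne_zero _ hk0) (by finiteness), one_mul]
      _ ≤ _ := by gcongr
  calc weightedRearrangement Φ (maximalFun f) t
      ≤ (youngInv Φ (1 / t))⁻¹ *
          ((5 ^ n + 1) * ∑' j : ℕ, a ^ j * rearrangement f (a ^ (j + 1) * t)) := by
        unfold weightedRearrangement
        gcongr
        exact rearrangement_maximalFun_le f ha1 ht'
    _ = (5 ^ n + 1) * ∑' j : ℕ,
          a ^ j * ((youngInv Φ (1 / t))⁻¹ * rearrangement f (a ^ (j + 1) * t)) := by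
        rw [mul_left_comm, ← ENNReal.tsum_mul_left]
        simp only [mul_left_comm]
    _ ≤ (5 ^ n + 1) * ∑' j : ℕ,
          k * (2⁻¹ ^ j * weightedRearrangement Φ f (a ^ (j + 1) * t)) := by
        refine mul_le_mul_right (ENNReal.tsum_le_tsum fun j => ?_) _
        calc _ ≤ a ^ j * ((k ^ (j + 1) * (youngInv Φ (1 / (a ^ (j + 1) * t)))⁻¹) *
              rearrangement f (a ^ (j + 1) * t)) := by
              gcongr
              exact hw (j + 1)
          _ = _ := by
              rw [← hak, mul_pow, pow_succ, weightedRearrangement]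
              ring
    _ = _ := by rw [ENNReal.tsum_mul_left, mul_assoc]

end

/-! ### Dilation-invariant norms on the half-line -/

theorem lintegral_Ioi_comp_mul_div (F : ℝ≥0∞ → ℝ≥0∞) {c : ℝ≥0∞} (hc : c ≠ 0) (hc' : c ≠ ∞) :
    ∫⁻ t in Set.Ioi (0 : ℝ), F (c * ENNReal.ofReal t) / ENNReal.ofReal t =
      ∫⁻ t in Set.Ioi (0 : ℝ), F (ENNReal.ofReal t) / ENNReal.ofReal t := by
  have hb : 0 < c.toReal := ENNReal.toReal_pos hc hc'
  have himg : (fun t : ℝ => c.toReal * t) '' Set.Ioi 0 = Set.Ioi 0 := by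
    rw [Set.image_mul_left_Ioi hb, mul_zero]
  have h := lintegral_image_eq_lintegral_abs_deriv_mul (s := Set.Ioi (0 : ℝ))
    (f := fun t => c.toReal * t) (f' := fun _ => c.toReal) measurableSet_Ioi
    (fun x _ => by simpa using ((hasDerivAt_id x).const_mul c.toReal).hasDerivWithinAt)
    (mul_right_injective₀ hb.ne').injOn (fun t => F (ENNReal.ofReal t) / ENNReal.ofReal t)
  rw [himg] at h
  rw [h]
  refine setLIntegral_congr_fun measurableSet_Ioi fun t ht => ?_
  have ht0 : ENNReal.ofReal t ≠ 0 := by simpa using ht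
  simp only [abs_of_pos hb]
  rw [ENNReal.ofReal_mul hb.le, ENNReal.ofReal_toReal hc', ← mul_div_assoc,
    ENNReal.mul_div_mul_left _ _ hc hc']

/-- The norm of `L^q((0,∞), dt/t)`. -/
noncomputable def logNorm (q : ℝ≥0∞) (G : ℝ≥0∞ → ℝ≥0∞) : ℝ≥0∞ :=
  if q = ∞ then ⨆ (t : ℝ) (_ : 0 < t), G (ENNReal.ofReal t)
  else (∫⁻ t in Set.Ioi (0 : ℝ), G (ENNReal.ofReal t) ^ q.toReal / ENNReal.ofReal t) ^
    (1 / q.toReal)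

theorem iSup_rpow_le_tsum (x : ℕ → ℝ≥0∞) {p : ℝ} (hp : 0 < p) :
    (⨆ j, x j) ^ p ≤ ∑' j, x j ^ p := by
  rw [← ENNReal.le_rpow_inv_iff hp]
  refine iSup_le fun j => ?_
  rw [ENNReal.le_rpow_inv_iff hp]
  exact ENNReal.le_tsum j

theorem exists_logNorm_le {q : ℝ≥0∞} (hq : 0 < q) {a : ℝ≥0∞} (ha : a ≠ 0) (ha' : a ≠ ∞)
    {C : ℝ≥0∞} (hC : C ≠ ∞) :
    ∃ D : ℝ≥0, ∀ G H : ℝ≥0∞ → ℝ≥0∞, Measurable G →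
      (∀ t, t ≠ ∞ → H t ≤ C * ∑' j : ℕ, 2⁻¹ ^ j * G (a ^ (j + 1) * t)) →
      logNorm q H ≤ D * logNorm q G := by
  by_cases hqt : q = ∞
  · have hs : ∑' j : ℕ, (2⁻¹ : ℝ≥0∞) ^ j = 2 := by
      rw [ENNReal.tsum_geometric, ENNReal.one_sub_inv_two, inv_inv]
    refine ⟨(C * 2).toNNReal, fun G H _ hH => ?_⟩
    rw [ENNReal.coe_toNNReal (by finiteness)]
    simp only [logNorm, if_pos hqt]
    refine iSup₂_le fun t ht => (hH _ ENNReal.ofReal_ne_top).trans ?_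
    rw [mul_assoc, show ∀ x : ℝ≥0∞, 2 * x = (∑' j : ℕ, (2⁻¹ : ℝ≥0∞) ^ j) * x by simp [hs],
      ← ENNReal.tsum_mul_right]
    refine mul_le_mul_right (ENNReal.tsum_le_tsum fun j => mul_le_mul_right ?_ _) _
    have hfin : a ^ (j + 1) * ENNReal.ofReal t ≠ ∞ := by finiteness
    have h0 : a ^ (j + 1) * ENNReal.ofReal t ≠ 0 :=
      mul_ne_zero (pow_ne_zero _ ha) (by simpa using ht)
    rw [← ENNReal.ofReal_toReal hfin]
    exact le_iSup₂_of_le (f := fun (t : ℝ) (_ : 0 < t) => G (ENNReal.ofReal t)) _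
      (ENNReal.toReal_pos h0 hfin) le_rfl
  · set p := q.toReal with hp
    have hp0 : 0 < p := ENNReal.toReal_pos hq.ne' hqt
    -- With `θ = 2^(-1/2)`, split `2^(-j) = θ^j θ^j`: one factor bounds the sum by a supremum, the
    -- other makes the sum of `p`-th powers converge. This replaces Minkowski's inequality and so
    -- covers `p < 1`.
    obtain ⟨θ, hθθ, hθ1⟩ : ∃ θ : ℝ≥0∞, θ * θ = 2⁻¹ ∧ θ < 1 := by
      refine ⟨2⁻¹ ^ (1 / 2 : ℝ), ?_, ENNReal.rpow_lt_one (by simp) (by norm_num)⟩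
      rw [← ENNReal.rpow_add_of_nonneg _ _ (by norm_num) (by norm_num)]
      norm_num
    have hθp : θ ^ p < 1 := ENNReal.rpow_lt_one hθ1 hp0
    set K := ∑' j : ℕ, θ ^ j with hK
    have hKt : K ≠ ∞ := by
      rw [hK, ENNReal.tsum_geometric]
      exact ENNReal.inv_ne_top.2 (tsub_pos_of_lt hθ1).ne'
    set B := ∑' j : ℕ, (θ ^ p) ^ j with hB
    have hBt : B ≠ ∞ := by
      rw [hB, ENNReal.tsum_geometric]
      exact ENNReal.inv_ne_top.2 (tsub_pos_of_lt hθp).ne'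
    have hDt : ((C * K) ^ p * B) ^ (1 / p) ≠ ∞ := by
      refine ENNReal.rpow_ne_top_of_nonneg (by positivity) (ENNReal.mul_ne_top ?_ hBt)
      exact ENNReal.rpow_ne_top_of_nonneg hp0.le (by finiteness)
    refine ⟨(((C * K) ^ p * B) ^ (1 / p)).toNNReal, fun G H hG hH => ?_⟩
    rw [ENNReal.coe_toNNReal hDt]
    simp only [logNorm, if_neg hqt, ← hp]
    rw [← ENNReal.mul_rpow_of_nonneg _ _ (by positivity : 0 ≤ 1 / p)]
    refine ENNReal.rpow_le_rpow ?_ (by positivity)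
    have hpt : ∀ t, t ≠ ∞ →
        H t ^ p ≤ (C * K) ^ p * ∑' j : ℕ, (θ ^ p) ^ j * G (a ^ (j + 1) * t) ^ p := by
      intro t ht
      have h1 : H t ≤ (C * K) * ⨆ j : ℕ, θ ^ j * G (a ^ (j + 1) * t) := by
        refine (hH t ht).trans ?_
        rw [mul_assoc, hK, ← ENNReal.tsum_mul_right]
        refine mul_le_mul_right (ENNReal.tsum_le_tsum fun j => ?_) _
        rw [← hθθ, mul_pow, mul_assoc]
        refine mul_le_mul_right ?_ _
        exact le_iSup (fun j : ℕ => θ ^ j * G (a ^ (j + 1) * t)) j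
      calc H t ^ p ≤ ((C * K) * ⨆ j : ℕ, θ ^ j * G (a ^ (j + 1) * t)) ^ p :=
            ENNReal.rpow_le_rpow h1 hp0.le
        _ ≤ (C * K) ^ p * ∑' j : ℕ, (θ ^ j * G (a ^ (j + 1) * t)) ^ p := by
            rw [ENNReal.mul_rpow_of_nonneg _ _ hp0.le]
            gcongr
            exact iSup_rpow_le_tsum _ hp0
        _ = _ := by
            congr 2
            funext j
            rw [ENNReal.mul_rpow_of_nonneg _ _ hp0.le, ← ENNReal.rpow_natCast θ j,
              ← ENNReal.rpow_natCast (θ ^ p) j, ← ENNReal.rpow_mul, ← ENNReal.rpow_mul,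
              mul_comm p]
    have hmeas : ∀ j : ℕ, Measurable fun t : ℝ =>
        G (a ^ (j + 1) * ENNReal.ofReal t) ^ p / ENNReal.ofReal t := fun j =>
      ((hG.comp (measurable_const.mul ENNReal.measurable_ofReal)).pow_const p).div
        ENNReal.measurable_ofReal
    calc ∫⁻ t in Set.Ioi (0 : ℝ), H (ENNReal.ofReal t) ^ p / ENNReal.ofReal t
        ≤ ∫⁻ t in Set.Ioi (0 : ℝ), (C * K) ^ p * ∑' j : ℕ, (θ ^ p) ^ j *
            (G (a ^ (j + 1) * ENNReal.ofReal t) ^ p / ENNReal.ofReal t) := by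
          refine lintegral_mono fun t => ?_
          simp only [← mul_div_assoc]
          simp only [div_eq_mul_inv, ENNReal.tsum_mul_right]
          rw [← mul_assoc]
          gcongr
          exact hpt _ ENNReal.ofReal_ne_top
      _ = (C * K) ^ p * ∑' j : ℕ, (θ ^ p) ^ j * ∫⁻ t in Set.Ioi (0 : ℝ),
            G (a ^ (j + 1) * ENNReal.ofReal t) ^ p / ENNReal.ofReal t := by
          rw [lintegral_const_mul _ (Measurable.tsum fun j => (hmeas j).const_mul _),
            lintegral_tsum fun j => ((hmeas j).const_mul _).aemeasurable]
          congr 2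
          funext j
          rw [lintegral_const_mul _ (hmeas j)]
      _ = _ := by
          simp only [fun j : ℕ => lintegral_Ioi_comp_mul_div (fun t => G t ^ p)
            (pow_ne_zero (j + 1) ha) (ENNReal.pow_ne_top ha' : a ^ (j + 1) ≠ ∞)]
          rw [ENNReal.tsum_mul_right, mul_assoc]

theorem exists_lt_top_of_logNorm_lt_top {q : ℝ≥0∞} (hq : 0 < q) {G : ℝ≥0∞ → ℝ≥0∞}
    (hG : logNorm q G < ∞) {δ : ℝ≥0∞} (hδ : 0 < δ) : ∃ t, 0 < t ∧ t < δ ∧ G t < ∞ := by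
  obtain ⟨d, hd0, hdδ⟩ : ∃ d : ℝ, 0 < d ∧ ENNReal.ofReal d ≤ δ := by
    rcases eq_or_ne δ ∞ with rfl | h
    · exact ⟨1, one_pos, le_top⟩
    · exact ⟨δ.toReal, ENNReal.toReal_pos hδ.ne' h, (ENNReal.ofReal_toReal h).le⟩
  by_contra! hcon
  have hcon' : ∀ t ∈ Set.Ioo (0 : ℝ) d, G (ENNReal.ofReal t) = ∞ := fun t ht =>
    top_le_iff.1 (hcon _ (by simpa using ht.1)
      (((ENNReal.ofReal_lt_ofReal_iff hd0).2 ht.2).trans_le hdδ))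
  refine hG.ne (top_le_iff.1 ?_)
  by_cases hqt : q = ∞
  · simp only [logNorm, if_pos hqt]
    refine le_iSup₂_of_le (d / 2) (by positivity) ?_
    rw [hcon' _ ⟨by positivity, by linarith⟩]
  · have hp0 : 0 < q.toReal := ENNReal.toReal_pos hq.ne' hqt
    simp only [logNorm, if_neg hqt]
    rw [top_le_iff, ENNReal.rpow_eq_top_iff_of_pos (by positivity), ← top_le_iff]
    calc ∞ = ∫⁻ _ in Set.Ioo (0 : ℝ) d, ∞ := by
          rw [setLIntegral_const, ENNReal.top_mul (by simpa using hd0)]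
      _ ≤ ∫⁻ t in Set.Ioo (0 : ℝ) d, G (ENNReal.ofReal t) ^ q.toReal / ENNReal.ofReal t := by
          refine setLIntegral_mono' measurableSet_Ioo fun t ht => ?_
          rw [hcon' t ht, ENNReal.top_rpow_of_pos hp0, ENNReal.top_div_of_ne_top
            ENNReal.ofReal_ne_top]
      _ ≤ _ := lintegral_mono_set fun t ht => ht.1

/-! ### Boundedness on `L^{Φ,q}` -/

section

variable {ε : Type*} [TopologicalSpace ε] [ContinuousENorm ε] {n : ℕ} {Φ : ℝ≥0∞ → ℝ≥0∞}

/-- A finite norm makes `f*(t)` finite for arbitrarily small `t`, and `{|f| = ∞}` lies in `{|f| >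
f*(t)}`, of measure at most `t`. Applied to `Mf`, this gives membership in `L⁰`. -/
theorem IsYoung.ae_enorm_lt_top (hΦ : IsYoung Φ) {q : ℝ≥0∞} (hq : 0 < q) {f : (Fin n → ℝ) → ε}
    (hf : orliczLorentzNorm Φ q f < ∞) : ∀ᵐ x, ‖f x‖ₑ < ∞ := by
  simp only [lt_top_iff_ne_top]
  rw [ae_iff]
  refine le_antisymm (le_of_forall_gt_imp_ge_of_dense fun δ hδ => ?_) zero_le
  obtain ⟨t, ht0, htδ, ht⟩ := 
    exists_lt_top_of_logNorm_lt_top (G := weightedRearrangement Φ f) hq hf hδ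
  have hr : rearrangement f t < ∞ := by
    by_contra hcon
    rw [weightedRearrangement, top_le_iff.1 (not_lt.1 hcon), ENNReal.mul_top] at ht
    · exact lt_irrefl _ ht
    · exact ENNReal.inv_ne_zero.2 (hΦ.youngInv_ne_top (by simpa using ht0.ne'))
  refine (measure_mono fun x hx => ?_).trans ((distribFun_rearrangement_le f t).trans htδ.le)
  have hx' : ‖f x‖ₑ = ∞ := not_not.1 hx
  exact hr.trans_eq hx'.symm

theorem exists_orliczLorentzNorm_maximalFun_le (hΦ₂ : Nabla2 Φ) {q : ℝ≥0∞} (hq : 0 < q) (n : ℕ) :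
    ∃ C : ℝ≥0, ∀ f : (Fin n → ℝ) → ε,
      orliczLorentzNorm Φ q (maximalFun f) ≤ C * orliczLorentzNorm Φ q f := by
  obtain ⟨k, hk, h⟩ := hΦ₂
  have hk0 : (k : ℝ≥0∞) ≠ 0 := by simpa using (zero_lt_one.trans hk).ne'
  obtain ⟨D, hD⟩ := exists_logNorm_le hq (a := (2 * (k : ℝ≥0∞))⁻¹) (C := (5 ^ n + 1) * k)
    (ENNReal.inv_ne_zero.2 (by finiteness)) (by simp [hk0]) (by finiteness)
  exact ⟨D, fun f => hD _ _ (measurable_weightedRearrangement Φ f)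
    fun t ht => weightedRearrangement_maximalFun_le hk h f ht⟩

theorem IsYoung.exists_bound_maximalFun (hΦ : IsYoung Φ) (hΦ₂ : Nabla2 Φ) {q : ℝ≥0∞} (hq : 0 < q)
    (n : ℕ) :
    ∃ C : ℝ≥0, ∀ f : (Fin n → ℝ) → ε, orliczLorentzNorm Φ q f < ∞ →
      MemOrliczLorentz Φ q (maximalFun f) ∧
        orliczLorentzNorm Φ q (maximalFun f) ≤ C * orliczLorentzNorm Φ q f := by
  obtain ⟨C, hC⟩ := exists_orliczLorentzNorm_maximalFun_le (ε := ε) hΦ₂ hq n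
  refine ⟨C, fun f hf => ?_⟩
  have hlt : orliczLorentzNorm Φ q (maximalFun f) < ∞ :=
    (hC f).trans_lt (ENNReal.mul_lt_top ENNReal.coe_lt_top hf)
  exact ⟨⟨⟨(measurable_maximalFun f).aestronglyMeasurable, hΦ.ae_enorm_lt_top hq hlt⟩, hlt⟩, hC f⟩

/-! ### Identification of `wL^Φ` with `L^{Φ,∞}` -/

theorem distribFun_div (g : (Fin n → ℝ) → ℝ≥0∞) {l : ℝ≥0∞} (hl : l ≠ 0) (hl' : l ≠ ∞) (t : ℝ≥0∞) :
    distribFun (fun x => g x / l) t = distribFun g (l * t) := by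
  unfold distribFun
  congr 1
  ext x
  simp only [Set.mem_ofPred_eq]
  rw [ENNReal.lt_div_iff_mul_lt (Or.inl hl) (Or.inl hl'), mul_comm]

/-- If `Φ(t) > 1/τ`, the hypothesis gives `m(f, lt) ≤ τ`, hence `f*(τ) ≤ lt`; then take the infimum
over such `t`. -/
theorem IsYoung.orliczLorentzNorm_top_le (hΦ : IsYoung Φ) {f : (Fin n → ℝ) → ε} {l : ℝ≥0∞}
    (hl : 0 < l) (hl' : l < ∞)
    (h : (⨆ (t : ℝ≥0) (_ : 0 < t), Φ t * distribFun (fun x => ‖f x‖ₑ / l) t) ≤ 1) :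
    orliczLorentzNorm Φ ∞ f ≤ l := by
  simp only [orliczLorentzNorm, if_pos]
  refine iSup₂_le fun τ hτ => ?_
  have hτ0 : ENNReal.ofReal τ ≠ 0 := by simpa using hτ
  have hr : rearrangement f (ENNReal.ofReal τ) ≤ youngInv Φ (1 / ENNReal.ofReal τ) * l := by
    rw [← ENNReal.div_le_iff hl.ne' hl'.ne]
    refine le_sInf fun t ht => ?_
    rw [ENNReal.div_le_iff hl.ne' hl'.ne]
    have ht' : 1 / ENNReal.ofReal τ < Φ t := ht
    induction t with
    | top => rw [ENNReal.top_mul hl.ne']; exact le_top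
    | coe t =>
      have ht0 : 0 < t := by
        rw [pos_iff_ne_zero]
        rintro rfl
        rw [ENNReal.coe_zero, hΦ.map_zero] at ht'
        exact not_lt_zero ht'
      refine sInf_le ⟨ENNReal.mul_pos (by simpa using ht0.ne') hl.ne', ?_⟩
      have h1 := (le_iSup₂ (f := fun (t : ℝ≥0) (_ : 0 < t) =>
        Φ t * distribFun (fun x => ‖f x‖ₑ / l) t) t ht0).trans h
      rw [distribFun_div _ hl.ne' hl'.ne, mul_comm l] at h1
      have h2 : 1 / ENNReal.ofReal τ * distribFun (fun x => ‖f x‖ₑ) (t * l) ≤ 1 :=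
        le_trans (by gcongr) h1
      rw [one_div, mul_comm, ← div_eq_mul_inv] at h2
      simpa using (ENNReal.div_le_iff hτ0 ENNReal.ofReal_ne_top).1 h2
  calc _ ≤ (youngInv Φ (1 / ENNReal.ofReal τ))⁻¹ * (youngInv Φ (1 / ENNReal.ofReal τ) * l) := by
        gcongr
    _ ≤ l := by
        rw [← mul_assoc]
        exact mul_le_of_le_one_left zero_le (ENNReal.inv_mul_le_one _)

theorem iSup_mul_distribFun_div_le {f : (Fin n → ℝ) → ε} {l : ℝ≥0∞}
    (hl : orliczLorentzNorm Φ ∞ f < l) (hl' : l < ∞) :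
    (⨆ (t : ℝ≥0) (_ : 0 < t), Φ t * distribFun (fun x => ‖f x‖ₑ / l) t) ≤ 1 := by
  have hl0 : l ≠ 0 := (zero_le.trans_lt hl).ne'
  refine iSup₂_le fun t ht => ?_
  rw [distribFun_div _ hl0 hl'.ne]
  by_contra! hcon
  -- Stepping below `Φ(t)` makes `u` finite and yields `Φ⁻¹(u) ≤ t`, whose definition needs a strict
  -- inequality. The norm is then tested at `1/u`.
  obtain ⟨u, hu, hu1⟩ : ∃ u < Φ t, 1 < u * distribFun (fun x => ‖f x‖ₑ) (l * t) := by
    by_contra! hc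
    exact absurd hcon (not_lt.2 (ENNReal.mul_le_of_forall_lt fun u hu v hv =>
      (mul_le_mul_right hv.le u).trans (hc u hu)))
  have hu0 : u ≠ 0 := by
    rintro rfl
    simp at hu1
  have hut : u ≠ ∞ := hu.ne_top
  have hN : (youngInv Φ u)⁻¹ * rearrangement f u⁻¹ ≤ l := by
    refine le_trans ?_ hl.le
    have := le_iSup₂ (f := fun (τ : ℝ) (_ : 0 < τ) =>
      (youngInv Φ (1 / ENNReal.ofReal τ))⁻¹ * rearrangement f (ENNReal.ofReal τ))
      u⁻¹.toReal (ENNReal.toReal_pos (ENNReal.inv_ne_zero.2 hut) (ENNReal.inv_ne_top.2 hu0))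
    simp only [ENNReal.ofReal_toReal (ENNReal.inv_ne_top.2 hu0), one_div, inv_inv] at this
    simpa only [orliczLorentzNorm, if_pos, one_div] using this
  have hy : youngInv Φ u ≤ t := sInf_le hu
  have hr : rearrangement f u⁻¹ ≤ l * t := by
    rw [mul_comm, ← div_eq_mul_inv] at hN
    have ht0 : (t : ℝ≥0∞) ≠ 0 := by simpa using ht.ne'
    rw [← ENNReal.div_le_iff ht0 ENNReal.coe_ne_top]
    exact (ENNReal.div_le_div_left hy _).trans hN
  have h1 := distribFun_le_of_rearrangement_le hr
  refine absurd hu1 (not_lt.2 ?_)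
  calc _ ≤ u * u⁻¹ := by gcongr
    _ ≤ 1 := ENNReal.mul_inv_le_one u

theorem IsYoung.weakOrliczNorm_eq (hΦ : IsYoung Φ) (f : (Fin n → ℝ) → ε) :
    weakOrliczNorm Φ f = orliczLorentzNorm Φ ∞ f := by
  refine le_antisymm (le_of_forall_gt_imp_ge_of_dense fun l hl => ?_)
    (le_sInf fun l hl => hΦ.orliczLorentzNorm_top_le hl.1 hl.2.1 hl.2.2)
  rcases eq_or_ne l ∞ with rfl | hl'
  · exact le_top
  · exact sInf_le ⟨zero_le.trans_lt hl, hl'.lt_top, iSup_mul_distribFun_div_le hl hl'.lt_top⟩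

theorem IsYoung.memWeakOrlicz_iff (hΦ : IsYoung Φ) (hΦ₂ : Nabla2 Φ) (f : (Fin n → ℝ) → ε) :
    MemWeakOrlicz Φ f ↔ MemOrliczLorentz Φ ∞ f := by
  refine and_congr_right fun _ => ⟨?_, fun h => ?_⟩
  · rintro ⟨c, hc, hB⟩
    obtain ⟨k, hk, h⟩ := hΦ₂
    set B := ⨆ (t : ℝ≥0) (_ : 0 < t), Φ t * distribFun (fun x => c * ‖f x‖ₑ) t with hBdef
    have hk0 : 0 < k := zero_lt_one.trans hk
    have hk0' : (k : ℝ≥0∞) ≠ 0 := by simpa using hk0.ne'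
    have hc0 : (c : ℝ≥0∞) ≠ 0 := by simpa using hc.ne'
    -- Membership only gives a finite bound `B`, whereas the norm asks for 1: `∇₂` trades the factor
    -- `(2k)^j ≥ B` for a dilation of the argument by `k^j`.
    obtain ⟨j, hj⟩ : ∃ j : ℕ, B ≤ (2 * (k : ℝ≥0∞)) ^ j := by
      obtain ⟨j, hj⟩ := pow_unbounded_of_one_lt B.toNNReal
        (lt_of_lt_of_le hk (le_mul_of_one_le_left zero_le one_le_two) : 1 < 2 * k)
      refine ⟨j, ?_⟩
      rw [← ENNReal.coe_toNNReal hB.ne]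
      exact_mod_cast hj.le
    have hp0 : (2 * (k : ℝ≥0∞)) ^ j ≠ 0 := pow_ne_zero _ (mul_ne_zero two_ne_zero hk0')
    have hl0 : (k : ℝ≥0∞) ^ j / c ≠ 0 := (ENNReal.div_pos (pow_ne_zero _ hk0') (by finiteness)).ne'
    have hlt : (k : ℝ≥0∞) ^ j / c ≠ ∞ := ENNReal.div_ne_top (by finiteness) hc0
    refine (hΦ.orliczLorentzNorm_top_le hl0.bot_lt hlt.lt_top
      (iSup₂_le fun t ht => ?_)).trans_lt hlt.lt_top
    have hset : distribFun (fun x => ‖f x‖ₑ / ((k : ℝ≥0∞) ^ j / c)) t =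
        distribFun (fun x => c * ‖f x‖ₑ) (k ^ j * t) := by
      rw [distribFun_div _ hl0 hlt]
      unfold distribFun
      congr 1
      ext x
      simp only [Set.mem_ofPred_eq]
      rw [mul_comm (c : ℝ≥0∞), ← ENNReal.div_lt_iff (Or.inl hc0) (Or.inl ENNReal.coe_ne_top),
        ENNReal.mul_div_right_comm]
    have h1 := le_iSup₂ (f := fun (t : ℝ≥0) (_ : 0 < t) =>
        Φ t * distribFun (fun x => c * ‖f x‖ₑ) t) (k ^ j * t) (by positivity)
    rw [← hBdef] at h1
    push_cast at h1
    rw [hset, ← ENNReal.mul_le_mul_iff_right hp0 (by finiteness), mul_one, ← mul_assoc]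
    refine le_trans ?_ (h1.trans hj)
    gcongr
    exact two_mul_pow_mul_le hk h j t
  · obtain ⟨l, hl, hl'⟩ := exists_between h
    have hl0 : l ≠ 0 := (zero_le.trans_lt hl).ne'
    refine ⟨l⁻¹.toNNReal, ENNReal.toNNReal_pos (ENNReal.inv_ne_zero.2 hl'.ne)
      (ENNReal.inv_ne_top.2 hl0), ?_⟩
    refine lt_of_le_of_lt ?_ ENNReal.one_lt_top
    rw [ENNReal.coe_toNNReal (ENNReal.inv_ne_top.2 hl0)]
    simpa only [div_eq_mul_inv, mul_comm] using iSup_mul_distribFun_div_le hl hl'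

end

end OrliczLorentz

theorem mainTheorem3 (n : ℕ) (Φ : ℝ≥0∞ → ℝ≥0∞)
    (hΦ : OrliczLorentz.IsYoung Φ) (hΦ₂ : OrliczLorentz.Nabla2 Φ) :
    (∀ q : ℝ≥0∞, 0 < q →
      ∃ C : ℝ≥0, ∀ f : (Fin n → ℝ) → ℂ, OrliczLorentz.MemOrliczLorentz Φ q f →
        OrliczLorentz.MemOrliczLorentz Φ q (OrliczLorentz.maximalFun f) ∧
        OrliczLorentz.orliczLorentzNorm Φ q (OrliczLorentz.maximalFun f) ≤
          C * OrliczLorentz.orliczLorentzNorm Φ q f) ∧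
    (∃ C : ℝ≥0, ∀ f : (Fin n → ℝ) → ℂ, OrliczLorentz.MemWeakOrlicz Φ f →
        OrliczLorentz.MemWeakOrlicz Φ (OrliczLorentz.maximalFun f) ∧
        OrliczLorentz.weakOrliczNorm Φ (OrliczLorentz.maximalFun f) ≤
          C * OrliczLorentz.weakOrliczNorm Φ f) := by
  refine ⟨fun q hq => ?_, ?_⟩
  · obtain ⟨C, hC⟩ := hΦ.exists_bound_maximalFun (ε := ℂ) hΦ₂ hq n
    exact ⟨C, fun f hf => hC f hf.2⟩
  · obtain ⟨C, hC⟩ := hΦ.exists_bound_maximalFun (ε := ℂ) hΦ₂ ENNReal.zero_lt_top n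
    refine ⟨C, fun f hf => ?_⟩
    rw [hΦ.memWeakOrlicz_iff hΦ₂, hΦ.weakOrliczNorm_eq, hΦ.weakOrliczNorm_eq]
    exact hC f ((hΦ.memWeakOrlicz_iff hΦ₂ f).1 hf).2
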